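/- Let $N, M > 1$ and let $A$ and $B$ be an $N\times N$ and an $M\times M$ matrix with entries in $\{0,1\}$, both irreducible and satisfying condition (I) of Cuntz and Krieger (from every state there is a path to a state at which there are two distinct first-return loops). Let $X_A=\{(x_n)_{n\in\mathbb N}\in\{1,\dots,N\}^{\mathbb N} : A(x_n,x_{n+1})=1 \text{ for all } n\}$ with the product topology and the shift $\sigma_A((x_n)_n)=(x_{n+1})_n$, let $\bar X_A$ be the analogous space of two-sided sequences $(x_n)_{n\in\mathbb Z}$ with the shift homeomorphism $\bar\sigma_A$, and let $\bar\sigma_A^*$ be the automorphism $f\mapsto f\circ\bar\sigma_A^{-1}$ of the $C^*$-algebra $C(\bar X_A)$ of complex-valued continuous functions on $\bar X_A$; similarly for $B$. Suppose that the one-sided topological Markov shifts $(X_A,\sigma_A)$ and $(X_B,\sigma_B)$ are strongly continuous orbit equivalent, that is, there is a homeomorphism $h:X_A\to X_B$ for which there are continuous functions $k_1,l_1:X_A\to\mathbb Z_{\ge 0}$, $b_1:X_A\to\mathbb Z$ and $k_2,l_2:X_B\to\mathbb Z_{\ge 0}$, $b_2:X_B\to\mathbb Z$ such that $$\sigma_B^{k_1(x)}(h(\sigma_A(x)))=\sigma_B^{l_1(x)}(h(x)),\qquad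 l_1(x)-k_1(x)=1+b_1(x)-b_1(\sigma_A(x))\qquad (x\in X_A),$$ $$\sigma_A^{k_2(y)}(h^{-1}(\sigma_B(y)))=\sigma_A^{l_2(y)}(h^{-1}(y)),\qquad l_2(y)-k_2(y)=1+b_2(y)-b_2(\sigma_B(y))\qquad (y\in X_B).$$ Then the $C^*$-crossed products are isomorphic as $C^*$-algebras: $$C(\bar X_A)\rtimes_{\bar\sigma_A^*}\mathbb Z\;\cong\;C(\bar X_B)\rtimes_{\bar\sigma_B^*}\mathbb Z.$$ -/

import Mathlib

open Topology Set
open scoped ENNReal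

/-! ### Topological Markov shifts -/

section Shifts

/-- A *return word* of `A` at the state `i`: a word `v` avoiding `i` such that `i v i` is
admissible, so that `i v i` is a loop at `i` which meets `i` only at its two ends. -/
def IsReturnWord {N : ℕ} (A : Matrix (Fin N) (Fin N) ℤ) (i : Fin N) (v : List (Fin N)) : Prop :=
  i ∉ v ∧ List.IsChain (fun a b => A a b = 1) (i :: (v ++ [i]))

/-- Condition (I) of Cuntz and Krieger: from every state `i` there is a path (possibly of length
zero) to a state `j` which has two distinct return words. -/
def ConditionI {N : ℕ} (A : Matrix (Fin N) (Fin N) ℤ) : Prop :=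
  ∀ i, ∃ j, Relation.ReflTransGen (fun a b => A a b = 1) i j ∧
    ∃ v w, v ≠ w ∧ IsReturnWord A j v ∧ IsReturnWord A j w

/-- The one-sided shift space `X_A`, with coordinates indexed by `0, 1, 2, …`; it carries the
subspace topology of the product topology. -/
def OneSidedShift {N : ℕ} (A : Matrix (Fin N) (Fin N) ℤ) : Set (ℕ → Fin N) :=
  {x | ∀ n, A (x n) (x (n + 1)) = 1}

/-- The shift transformation `σ_A` of `X_A`. -/
def oneSidedShiftMap {N : ℕ} (A : Matrix (Fin N) (Fin N) ℤ) (x : OneSidedShift A) :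
    OneSidedShift A :=
  ⟨fun n => x.1 (n + 1), fun n => x.2 (n + 1)⟩

/-- The two-sided shift space `X̄_A`, with the subspace topology of the product topology. -/
def TwoSidedShift {N : ℕ} (A : Matrix (Fin N) (Fin N) ℤ) : Set (ℤ → Fin N) :=
  {x | ∀ n, A (x n) (x (n + 1)) = 1}

/-- The shift homeomorphism `σ̄_A` of `X̄_A`. -/
def twoSidedShiftHomeo {N : ℕ} (A : Matrix (Fin N) (Fin N) ℤ) :
    TwoSidedShift A ≃ₜ TwoSidedShift A where
  toFun x := ⟨fun n => x.1 (n + 1), fun n => x.2 (n + 1)⟩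
  invFun x := ⟨fun n => x.1 (n - 1), fun n => by
    have h := x.2 (n - 1)
    rwa [show n - 1 + 1 = n + 1 - 1 by ring] at h⟩
  left_inv x := by ext n; simp
  right_inv x := by ext n; simp
  continuous_toFun := by
    refine Continuous.subtype_mk (continuous_pi fun n => ?_) _
    exact (continuous_apply (n + 1)).comp continuous_subtype_val
  continuous_invFun := by
    refine Continuous.subtype_mk (continuous_pi fun n => ?_) _
    exact (continuous_apply (n - 1)).comp continuous_subtype_val

theorem isClosed_twoSidedShift {N : ℕ} (A : Matrix (Fin N) (Fin N) ℤ) :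
    IsClosed (TwoSidedShift A) := by
  rw [show TwoSidedShift A = ⋂ n : ℤ, {x | A (x n) (x (n + 1)) = 1} by
    ext x; simp [TwoSidedShift]]
  refine isClosed_iInter fun n => ?_
  have hc : Continuous fun x : ℤ → Fin N => (x n, x (n + 1)) := by fun_prop
  exact (isClosed_discrete {p : Fin N × Fin N | A p.1 p.2 = 1}).preimage hc

instance instCompactSpaceTwoSidedShift {N : ℕ} (A : Matrix (Fin N) (Fin N) ℤ) :
    CompactSpace (TwoSidedShift A) :=
  isCompact_iff_compactSpace.mp (isClosed_twoSidedShift A).isCompact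

end Shifts

/-! ### Strongly continuous orbit equivalence -/

section OrbitEquivalence

/-- `k, l : X_A → ℤ₊` are continuous and `σ_B^{k(x)} (h (σ_A x)) = σ_B^{l(x)} (h x)`. -/
def IsOrbitPair {N M : ℕ} (A : Matrix (Fin N) (Fin N) ℤ) (B : Matrix (Fin M) (Fin M) ℤ)
    (h : OneSidedShift A → OneSidedShift B) (k l : OneSidedShift A → ℕ) : Prop :=
  Continuous k ∧ Continuous l ∧
    ∀ x, (oneSidedShiftMap B)^[k x] (h (oneSidedShiftMap A x)) = (oneSidedShiftMap B)^[l x] (h x)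

/-- Continuous orbit maps `(X_A, σ_A) → (X_B, σ_B)`. -/
def IsContinuousOrbitMap {N M : ℕ} (A : Matrix (Fin N) (Fin N) ℤ) (B : Matrix (Fin M) (Fin M) ℤ)
    (h : OneSidedShift A → OneSidedShift B) : Prop :=
  IsLocalHomeomorph h ∧ ∃ k l, IsOrbitPair A B h k l

/-- `Ψ_h(f)(x) = ∑_{i < l(x)} f(σ_B^i (h x)) - ∑_{j < k(x)} f(σ_B^j (h (σ_A x)))`. -/
def orbitPullback {N M : ℕ} (A : Matrix (Fin N) (Fin N) ℤ) (B : Matrix (Fin M) (Fin M) ℤ)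
    (h : OneSidedShift A → OneSidedShift B) (k l : OneSidedShift A → ℕ)
    (f : OneSidedShift B → ℤ) (x : OneSidedShift A) : ℤ :=
  ∑ i ∈ Finset.range (l x), f ((oneSidedShiftMap B)^[i] (h x)) -
    ∑ j ∈ Finset.range (k x), f ((oneSidedShiftMap B)^[j] (h (oneSidedShiftMap A x)))

/-- Strongly continuous orbit maps: continuous orbit maps `h` for which `Ψ_h(1)` is cohomologous
to `1`, that is `Ψ_h(1) = 1 + b - b ∘ σ_A` with `b : X_A → ℤ` continuous. -/
def IsStronglyContinuousOrbitMap {N M : ℕ} (A : Matrix (Fin N) (Fin N) ℤ)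
    (B : Matrix (Fin M) (Fin M) ℤ) (h : OneSidedShift A → OneSidedShift B) : Prop :=
  IsLocalHomeomorph h ∧ ∃ k l, IsOrbitPair A B h k l ∧
    ∃ b : OneSidedShift A → ℤ, Continuous b ∧
      ∀ x, orbitPullback A B h k l (fun _ => 1) x = 1 + b x - b (oneSidedShiftMap A x)

/-- Continuous orbit homeomorphisms. -/
def IsContinuousOrbitHomeo {N M : ℕ} (A : Matrix (Fin N) (Fin N) ℤ)
    (B : Matrix (Fin M) (Fin M) ℤ) (h : OneSidedShift A ≃ₜ OneSidedShift B) : Prop :=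
  IsContinuousOrbitMap A B h ∧ IsContinuousOrbitMap B A h.symm

/-- Strongly continuous orbit homeomorphisms. -/
def IsStronglyContinuousOrbitHomeo {N M : ℕ} (A : Matrix (Fin N) (Fin N) ℤ)
    (B : Matrix (Fin M) (Fin M) ℤ) (h : OneSidedShift A ≃ₜ OneSidedShift B) : Prop :=
  IsContinuousOrbitHomeo A B h ∧ IsStronglyContinuousOrbitMap A B h

/-- Strong continuous orbit equivalence of `(X_A, σ_A)` and `(X_B, σ_B)`. -/
def StronglyContinuousOrbitEquivalent {N M : ℕ} (A : Matrix (Fin N) (Fin N) ℤ)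
    (B : Matrix (Fin M) (Fin M) ℤ) : Prop :=
  ∃ h : OneSidedShift A ≃ₜ OneSidedShift B,
    IsStronglyContinuousOrbitHomeo A B h ∧ IsStronglyContinuousOrbitHomeo B A h.symm

end OrbitEquivalence

/-! ### Crossed products by `ℤ` -/

noncomputable section CrossedProduct

universe u

/-- A covariant representation of `(𝒜, α, ℤ)`, for an automorphism `α` of a unital C*-algebra `𝒜`:
a unital *-representation `π` of `𝒜` on a nonzero Hilbert space `H` and a unitary `U` on `H` with
`U π(a) U* = π(α a)`. -/
structure CovariantRep {𝒜 : Type u} [CStarAlgebra 𝒜] (α : 𝒜 ≃⋆ₐ[ℂ] 𝒜) : Type (u + 1) where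
  /-- The Hilbert space. -/
  H : Type u
  [normed : NormedAddCommGroup H]
  [inner : InnerProductSpace ℂ H]
  [complete : CompleteSpace H]
  [nontrivial : Nontrivial H]
  /-- The representation of the algebra. -/
  π : 𝒜 →⋆ₐ[ℂ] (H →L[ℂ] H)
  /-- The unitary which implements the automorphism. -/
  U : unitary (H →L[ℂ] H)
  covariant : ∀ a, (U : H →L[ℂ] H) * π a * star (U : H →L[ℂ] H) = π (α a)

attribute [instance] CovariantRep.normed CovariantRep.inner CovariantRep.complete
  CovariantRep.nontrivial

/-- The C*-algebra `∏_ρ B(H_ρ)` of bounded families of operators, over all covariant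
representations `ρ`, with the supremum norm. -/
abbrev CovariantFamily {𝒜 : Type u} [CStarAlgebra 𝒜] (α : 𝒜 ≃⋆ₐ[ℂ] 𝒜) : Type (u + 1) :=
  lp (fun ρ : CovariantRep α => ρ.H →L[ℂ] ρ.H) ∞

instance instCStarAlgebraCovariantFamily {𝒜 : Type u} [CStarAlgebra 𝒜] (α : 𝒜 ≃⋆ₐ[ℂ] 𝒜) :
    CStarAlgebra (CovariantFamily α) where

/-- The family `(π_ρ(a))_ρ`. -/
def universalRep {𝒜 : Type u} [CStarAlgebra 𝒜] (α : 𝒜 ≃⋆ₐ[ℂ] 𝒜) (a : 𝒜) : CovariantFamily α :=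
  ⟨fun ρ => ρ.π a, memℓp_infty ⟨‖a‖, by
    rintro _ ⟨ρ, rfl⟩
    exact NonUnitalStarAlgHom.norm_apply_le ρ.π a⟩⟩

/-- The family `(U_ρ)_ρ`. -/
def universalUnitary {𝒜 : Type u} [CStarAlgebra 𝒜] (α : 𝒜 ≃⋆ₐ[ℂ] 𝒜) : CovariantFamily α :=
  ⟨fun ρ => (ρ.U : ρ.H →L[ℂ] ρ.H), memℓp_infty ⟨1, by
    rintro _ ⟨ρ, rfl⟩
    exact CStarRing.norm_coe_unitary ρ.U |>.le⟩⟩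

/-- The C*-subalgebra generated by the families `(π_ρ(a))_ρ`, `a ∈ 𝒜`, and `(U_ρ)_ρ`. -/
def crossedProductSubalgebra {𝒜 : Type u} [CStarAlgebra 𝒜] (α : 𝒜 ≃⋆ₐ[ℂ] 𝒜) :
    StarSubalgebra ℂ (CovariantFamily α) :=
  (StarAlgebra.adjoin ℂ (range (universalRep α) ∪ {universalUnitary α})).topologicalClosure

/-- The (full) C*-crossed product `𝒜 ⋊_α ℤ`: the C*-algebra generated by the copy of `𝒜` and the
implementing unitary in the direct sum of all covariant representations. In other words, it is the
completion of the twisted convolution algebra of finite sums `∑ a_n u^n` in the norm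
`‖x‖ = sup_ρ ‖(π_ρ × U_ρ)(x)‖`. -/
def CrossedProduct {𝒜 : Type u} [CStarAlgebra 𝒜] (α : 𝒜 ≃⋆ₐ[ℂ] 𝒜) : Type (u + 1) :=
  crossedProductSubalgebra α

instance instCStarAlgebraCrossedProduct {𝒜 : Type u} [CStarAlgebra 𝒜] (α : 𝒜 ≃⋆ₐ[ℂ] 𝒜) :
    CStarAlgebra (CrossedProduct α) :=
  StarSubalgebra.cstarAlgebra (crossedProductSubalgebra α)
    (h_closed := StarSubalgebra.isClosed_topologicalClosure _)

/-- The automorphism `σ̄_A^*(f) = f ∘ σ̄_A⁻¹` of `C(X̄_A)`. -/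
def twoSidedShiftAut {N : ℕ} (A : Matrix (Fin N) (Fin N) ℤ) :
    C(TwoSidedShift A, ℂ) ≃⋆ₐ[ℂ] C(TwoSidedShift A, ℂ) :=
  (twoSidedShiftHomeo A).symm.compStarAlgEquiv' ℂ ℂ

end CrossedProduct

/-!
Let `c = D + b` with `D` so large that `l ≤ c`. The cohomology relation says precisely that
`p x = σ_B ^ c(x) (h x)` intertwines `σ_A` and `σ_B`, so `p` induces a map `p̄` of the two-sided
shifts, which are the natural extensions of the one-sided ones. The same construction for `h⁻¹`
gives `q̄`, and `q (p x) = σ_A ^ e(x) x` with `e` taking finitely many values. Along the coordinates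
of a two-sided point one value `d` of `e` recurs arbitrarily far to the left, which forces
`q̄ (p̄ x) = σ̄_A ^ d x`. Thus `q̄ ∘ p̄` and `p̄ ∘ q̄` preserve shift orbits, which is enough
for `p̄` to be bijective, hence a topological conjugacy; and conjugate homeomorphisms have
isomorphic crossed products.
-/

section Permutations

variable {X Y : Type*} {S : Equiv.Perm X} {T : Equiv.Perm Y} {p : X → Y} {q : Y → X}

theorem semiconj_perm_zpow (hp : Function.Semiconj p S T) (d : ℤ) :
    Function.Semiconj p (S ^ d : Equiv.Perm X) (T ^ d : Equiv.Perm Y) := by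
  have hpow (n : ℕ) : Function.Semiconj p (S ^ n : Equiv.Perm X) (T ^ n : Equiv.Perm Y) := by
    simpa only [Equiv.Perm.coe_pow] using hp.iterate_right n
  obtain ⟨n, rfl | rfl⟩ := d.eq_nat_or_neg
  · simpa only [zpow_natCast] using hpow n
  · rw [zpow_neg, zpow_neg, zpow_natCast, zpow_natCast]
    exact (hpow n).inverses_right (S ^ n).right_inv (T ^ n).left_inv

theorem injective_of_sameCycle (hp : Function.Semiconj p S T) (hq : Function.Semiconj q T S)
    (hqp : ∀ x, S.SameCycle x (q (p x))) : Function.Injective p := by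
  intro x x' hxx'
  obtain ⟨m, rfl⟩ : S.SameCycle x x' := (hqp x).trans (hxx' ▸ (hqp x').symm)
  obtain ⟨d, hd⟩ := hqp x
  have hfix : (T ^ m) (p x) = p x := by rw [← semiconj_perm_zpow hp, hxx']
  refine (S ^ d).injective ?_
  calc (S ^ d) x = q ((T ^ m) (p x)) := by rw [hfix, hd]
    _ = (S ^ m) ((S ^ d) x) := by rw [semiconj_perm_zpow hq, hd]
    _ = (S ^ d) ((S ^ m) x) := by rw [← Equiv.Perm.mul_apply, zpow_mul_comm, Equiv.Perm.mul_apply]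

theorem surjective_of_sameCycle (hp : Function.Semiconj p S T)
    (hpq : ∀ y, T.SameCycle (p (q y)) y) : Function.Surjective p := fun y => by
  obtain ⟨d, hd⟩ := hpq y
  exact ⟨(S ^ d) (q y), (semiconj_perm_zpow hp d _).trans hd⟩

end Permutations

section NaturalExtension

/-- The natural extension of `σ : X → X`, as the space of two-sided orbits of `σ`. It is the
inverse limit of `⋯ → X → X` with all bonding maps equal to `σ`, made invertible by the shift. -/
def NaturalExtension {X : Type*} (σ : X → X) : Set (ℤ → X) :=
  {x | ∀ n, σ (x n) = x (n + 1)}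

namespace NaturalExtension

variable {X Y : Type*} {σ : X → X} {τ : Y → Y}

theorem iterate_apply (x : NaturalExtension σ) (n : ℤ) (m : ℕ) :
    σ^[m] (x.1 n) = x.1 (n + m) := by
  induction m with
  | zero => simp
  | succ m ih => rw [Function.iterate_succ_apply', ih, x.2, Nat.cast_succ, add_assoc]

/-- The invertible map of the natural extension which lifts `σ`. -/
def shift (σ : X → X) : Equiv.Perm (NaturalExtension σ) where
  toFun x := ⟨fun n => x.1 (n + 1), fun n => x.2 (n + 1)⟩
  invFun x := ⟨fun n => x.1 (n - 1), fun n => by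
    simp only [x.2 (n - 1), sub_add_cancel, add_sub_cancel_right]⟩
  left_inv x := by ext n; simp
  right_inv x := by ext n; simp

theorem shift_zpow_apply (d : ℤ) (x : NaturalExtension σ) (n : ℤ) :
    ((shift σ ^ d) x).1 n = x.1 (n + d) := by
  induction d generalizing x with
  | zero => simp
  | succ d ih =>
    rw [zpow_add_one, Equiv.Perm.mul_apply, ih]
    exact congrArg x.1 (add_assoc n d 1)
  | pred d ih =>
    rw [zpow_sub_one, Equiv.Perm.mul_apply, ih]
    exact congrArg x.1 (add_sub_assoc n (-d : ℤ) 1)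

/-- The map of natural extensions induced by a semiconjugacy. -/
def map (p : X → Y) (hp : Function.Semiconj p σ τ) (x : NaturalExtension σ) :
    NaturalExtension τ :=
  ⟨fun n => p (x.1 n), fun n => by rw [← hp, x.2]⟩

theorem semiconj_map_shift {p : X → Y} (hp : Function.Semiconj p σ τ) :
    Function.Semiconj (map p hp) (shift σ) (shift τ) :=
  fun _ => rfl

theorem map_eq_shift_zpow {f : X → X} (hf : Function.Semiconj f σ σ) {e : X → ℕ}
    (hfe : ∀ x, f x = σ^[e x] x) {x : NaturalExtension σ} {d : ℕ}
    (hd : ∃ᶠ n in Filter.atBot, e (x.1 n) = d) : map f hf x = (shift σ ^ (d : ℤ)) x := by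
  ext n
  obtain ⟨m, hm, hmn⟩ := (hd.and_eventually (Filter.eventually_le_atBot n)).exists
  obtain ⟨t, rfl⟩ := Int.le.dest hmn
  calc f (x.1 (m + t)) = σ^[t] (f (x.1 m)) := by rw [← iterate_apply, hf.iterate_right t]
    _ = x.1 (m + t + d) := by
      rw [hfe, hm, iterate_apply, iterate_apply, add_right_comm]
    _ = ((shift σ ^ (d : ℤ)) x).1 (m + t) := (shift_zpow_apply _ x _).symm

theorem sameCycle_shift_map {f : X → X} (hf : Function.Semiconj f σ σ) {e : X → ℕ}
    (he : (range e).Finite) (hfe : ∀ x, f x = σ^[e x] x) (x : NaturalExtension σ) :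
    (shift σ).SameCycle x (map f hf x) := by
  obtain ⟨d, -, hd⟩ : ∃ d ∈ range e, ∃ᶠ n in Filter.atBot, e (x.1 n) = d :=
    (Filter.frequently_exists_finite he).1 (Filter.Frequently.of_forall fun n => by simp)
  exact ⟨d, (map_eq_shift_zpow hf hfe hd).symm⟩

variable [TopologicalSpace X]

theorem continuous_map [TopologicalSpace Y] {p : X → Y} (hp : Function.Semiconj p σ τ)
    (hc : Continuous p) : Continuous (map p hp) :=
  (continuous_pi fun n => hc.comp ((continuous_apply n).comp continuous_subtype_val)).subtype_mk _

theorem compactSpace [CompactSpace X] [T2Space X] (hσ : Continuous σ) :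
    CompactSpace (NaturalExtension σ) := by
  refine isCompact_iff_compactSpace.1 (IsClosed.isCompact ?_)
  rw [NaturalExtension, ofPred_forall]
  exact isClosed_iInter fun n =>
    isClosed_eq (hσ.comp (continuous_apply n)) (continuous_apply (n + 1))

end NaturalExtension

end NaturalExtension

section OrbitMaps

variable {X Y : Type*} {σ : X → X} {τ : Y → Y}

/-- The map `x ↦ τ ^ c(x) (h x)`, which follows `h` for a time depending on the point. -/
def iterateAlong (τ : Y → Y) (c : X → ℕ) (h : X → Y) (x : X) : Y :=
  τ^[c x] (h x)

theorem iterateAlong_iterateAlong {h : X → Y} {g : Y → X} {c : X → ℕ} {c' : Y → ℕ}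
    (hq : Function.Semiconj (iterateAlong σ c' g) τ σ) (hgh : Function.LeftInverse g h) (x : X) :
    iterateAlong σ c' g (iterateAlong τ c h x) = σ^[c x + c' (h x)] x :=
  calc iterateAlong σ c' g (τ^[c x] (h x)) = σ^[c x] (iterateAlong σ c' g (h x)) :=
        hq.iterate_right (c x) (h x)
    _ = σ^[c x + c' (h x)] x := by rw [iterateAlong, hgh, Function.iterate_add_apply]

theorem sameCycle_map_map_iterateAlong {h : X → Y} {g : Y → X} {c : X → ℕ} {c' : Y → ℕ}
    (hp : Function.Semiconj (iterateAlong τ c h) σ τ)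
    (hq : Function.Semiconj (iterateAlong σ c' g) τ σ) (hgh : Function.LeftInverse g h)
    (hc : (range c).Finite) (hc' : (range c').Finite) (x : NaturalExtension σ) :
    (NaturalExtension.shift σ).SameCycle x
      (NaturalExtension.map _ hq (NaturalExtension.map _ hp x)) := by
  refine NaturalExtension.sameCycle_shift_map (hp.trans hq) (e := fun x => c x + c' (h x))
    ((hc.image2 (· + ·) hc').subset ?_) (iterateAlong_iterateAlong hq hgh) x
  rintro _ ⟨x, rfl⟩
  exact mem_image2_of_mem (mem_range_self x) (mem_range_self (h x))

theorem semiconj_iterateAlong {h : X → Y} {k l c : X → ℕ}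
    (horbit : ∀ x, τ^[k x] (h (σ x)) = τ^[l x] (h x)) (hlc : ∀ x, l x ≤ c x + 1)
    (hcob : ∀ x, c (σ x) + l x = c x + 1 + k x) :
    Function.Semiconj (iterateAlong τ c h) σ τ := fun x => by
  obtain ⟨t, ht⟩ := Nat.exists_eq_add_of_le' (hlc x)
  have ht' : c (σ x) = t + k x := by grind
  calc τ^[c (σ x)] (h (σ x)) = τ^[t] (τ^[l x] (h x)) := by
        rw [ht', Function.iterate_add_apply, horbit]
    _ = τ (τ^[c x] (h x)) := by
      rw [← Function.iterate_add_apply, ← ht, Function.iterate_succ_apply']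

variable [TopologicalSpace X]

theorem continuous_iterateAlong [TopologicalSpace Y] {h : X → Y} {c : X → ℕ}
    (hτ : Continuous τ) (hc : Continuous c) (hh : Continuous h) :
    Continuous (iterateAlong τ c h) := by
  have heval : Continuous fun z : Y × ℕ => τ^[z.2] z.1 :=
    continuous_prod_of_discrete_right.2 hτ.iterate
  exact heval.comp (hh.prodMk hc)

theorem exists_semiconj_iterateAlong_of_cohomologous [CompactSpace X] {h : X → Y}
    {k l : X → ℕ} {b : X → ℤ} (hl : Continuous l) (hb : Continuous b)
    (horbit : ∀ x, τ^[k x] (h (σ x)) = τ^[l x] (h x))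
    (hcob : ∀ x, (l x : ℤ) - k x = 1 + b x - b (σ x)) :
    ∃ c : X → ℕ, Continuous c ∧ Function.Semiconj (iterateAlong τ c h) σ τ := by
  obtain ⟨D, hD⟩ : BddAbove (range fun x => (l x : ℤ) - b x) :=
    (isCompact_range ((continuous_of_discreteTopology.comp hl).sub hb)).bddAbove
  have hlD (x) : (l x : ℤ) ≤ D + b x := by linarith [hD (mem_range_self x)]
  refine ⟨fun x => (D + b x).toNat, ?_,
    semiconj_iterateAlong horbit (fun x => ?_) fun x => ?_⟩
  · exact (continuous_of_discreteTopology (f := fun z : ℤ => (D + z).toNat)).comp hb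
  · grind
  · grind

theorem exists_homeomorph_naturalExtension [TopologicalSpace Y] [CompactSpace X] [T2Space X]
    (hσ : Continuous σ) (hτ : Continuous τ) (h : X ≃ₜ Y) {c : X → ℕ} {c' : Y → ℕ}
    (hc : Continuous c) (hc' : Continuous c') (hp : Function.Semiconj (iterateAlong τ c h) σ τ)
    (hq : Function.Semiconj (iterateAlong σ c' h.symm) τ σ) :
    ∃ φ : NaturalExtension σ ≃ₜ NaturalExtension τ,
      Function.Semiconj φ (NaturalExtension.shift σ) (NaturalExtension.shift τ) := by
  have := h.compactSpace
  have := h.t2Space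
  have := NaturalExtension.compactSpace hσ
  have hfin := (isCompact_range hc).finite_of_discrete
  have hfin' := (isCompact_range hc').finite_of_discrete
  have hp' := NaturalExtension.semiconj_map_shift hp
  have hq' := NaturalExtension.semiconj_map_shift hq
  have hbij : Function.Bijective (NaturalExtension.map _ hp) :=
    ⟨injective_of_sameCycle hp' hq'
        (sameCycle_map_map_iterateAlong hp hq h.left_inv hfin hfin'),
      surjective_of_sameCycle hp' fun y =>
        (sameCycle_map_map_iterateAlong hq hp h.right_inv hfin' hfin y).symm⟩
  exact ⟨Continuous.homeoOfEquivCompactToT2 (f := Equiv.ofBijective _ hbij)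
    (NaturalExtension.continuous_map hp (continuous_iterateAlong hτ hc h.continuous)), hp'⟩

end OrbitMaps

section MarkovShifts

variable {N M : ℕ} {A : Matrix (Fin N) (Fin N) ℤ} {B : Matrix (Fin M) (Fin M) ℤ}

theorem isClosed_oneSidedShift (A : Matrix (Fin N) (Fin N) ℤ) : IsClosed (OneSidedShift A) := by
  rw [OneSidedShift, ofPred_forall]
  refine isClosed_iInter fun n => ?_
  have hpair : Continuous fun x : ℕ → Fin N => (x n, x (n + 1)) := by fun_prop
  exact (isClosed_discrete {p : Fin N × Fin N | A p.1 p.2 = 1}).preimage hpair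

instance compactSpace_oneSidedShift (A : Matrix (Fin N) (Fin N) ℤ) :
    CompactSpace (OneSidedShift A) :=
  isCompact_iff_compactSpace.1 (isClosed_oneSidedShift A).isCompact

theorem continuous_oneSidedShiftMap (A : Matrix (Fin N) (Fin N) ℤ) :
    Continuous (oneSidedShiftMap A) := by
  refine Continuous.subtype_mk (continuous_pi fun n => ?_) _
  exact (continuous_apply (n + 1)).comp continuous_subtype_val

theorem oneSidedShiftMap_iterate_apply (x : OneSidedShift A) (m i : ℕ) :
    ((oneSidedShiftMap A)^[m] x).1 i = x.1 (i + m) := by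
  induction m generalizing x with
  | zero => rfl
  | succ m ih =>
    rw [Function.iterate_succ_apply, ih]
    exact congrArg x.1 (add_assoc i m 1)

/-- The ray `x n, x (n + 1), …` of a two-sided sequence, which represents the coordinate `n` of
`x` in the natural extension of the one-sided shift. -/
def rightRay (x : TwoSidedShift A) (n : ℤ) : OneSidedShift A :=
  ⟨fun i => x.1 (n + i), fun i => by simpa only [Nat.cast_succ, add_assoc] using x.2 (n + i)⟩

theorem oneSidedShiftMap_rightRay (x : TwoSidedShift A) (n : ℤ) :
    oneSidedShiftMap A (rightRay x n) = rightRay x (n + 1) :=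
  Subtype.ext <| funext fun i => congrArg x.1 (by push_cast; ring)

theorem continuous_rightRay (n : ℤ) : Continuous fun x : TwoSidedShift A => rightRay x n := by
  refine Continuous.subtype_mk (continuous_pi fun i => ?_) _
  exact (continuous_apply (n + (i : ℤ))).comp continuous_subtype_val

theorem apply_zero_mem_twoSidedShift (y : NaturalExtension (oneSidedShiftMap A)) :
    (fun n => (y.1 n).1 0) ∈ TwoSidedShift A := fun n => by
  have hy : (y.1 (n + 1)).1 0 = (y.1 n).1 1 := by rw [← y.2 n]; rfl
  exact (congrArg (A ((y.1 n).1 0)) hy).trans ((y.1 n).2 0)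

/-- The identification of the two-sided shift space with the natural extension of the one-sided
shift, by the rays of a two-sided sequence in one direction and by the zeroth symbols of a sequence
of rays in the other. -/
def twoSidedShiftHomeoNaturalExtension (A : Matrix (Fin N) (Fin N) ℤ) :
    TwoSidedShift A ≃ₜ NaturalExtension (oneSidedShiftMap A) where
  toFun x := ⟨rightRay x, oneSidedShiftMap_rightRay x⟩
  invFun y := ⟨fun n => (y.1 n).1 0, apply_zero_mem_twoSidedShift y⟩
  left_inv x := Subtype.ext <| funext fun n => congrArg x.1 (add_zero n)
  right_inv y := by
    refine Subtype.ext (funext fun n => Subtype.ext (funext fun i => ?_))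
    change (y.1 (n + i)).1 0 = (y.1 n).1 i
    rw [← NaturalExtension.iterate_apply, oneSidedShiftMap_iterate_apply, zero_add]
  continuous_toFun := (continuous_pi continuous_rightRay).subtype_mk _
  continuous_invFun := by
    refine (continuous_pi fun n => ?_).subtype_mk _
    exact (continuous_apply 0).comp
      (continuous_subtype_val.comp ((continuous_apply n).comp continuous_subtype_val))

theorem semiconj_twoSidedShiftHomeoNaturalExtension (A : Matrix (Fin N) (Fin N) ℤ) :
    Function.Semiconj (twoSidedShiftHomeoNaturalExtension A) (twoSidedShiftHomeo A)
      (NaturalExtension.shift (oneSidedShiftMap A)) := fun x => by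
  refine Subtype.ext (funext fun n => Subtype.ext (funext fun i => ?_))
  exact congrArg x.1 (add_right_comm n (i : ℤ) 1)

theorem IsStronglyContinuousOrbitMap.exists_semiconj_iterateAlong
    {h : OneSidedShift A → OneSidedShift B} (hh : IsStronglyContinuousOrbitMap A B h) :
    ∃ c : OneSidedShift A → ℕ, Continuous c ∧
      Function.Semiconj (iterateAlong (oneSidedShiftMap B) c h) (oneSidedShiftMap A)
        (oneSidedShiftMap B) := by
  obtain ⟨-, k, l, ⟨-, hl, horbit⟩, b, hb, hcob⟩ := hh
  exact exists_semiconj_iterateAlong_of_cohomologous hl hb horbit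
    (by simpa [orbitPullback] using hcob)

theorem StronglyContinuousOrbitEquivalent.exists_conjugacy
    (hAB : StronglyContinuousOrbitEquivalent A B) :
    ∃ φ : TwoSidedShift A ≃ₜ TwoSidedShift B,
      Function.Semiconj φ (twoSidedShiftHomeo A) (twoSidedShiftHomeo B) := by
  obtain ⟨h, ⟨-, hh⟩, -, hg⟩ := hAB
  obtain ⟨c, hc, hp⟩ := hh.exists_semiconj_iterateAlong
  obtain ⟨c', hc', hq⟩ := hg.exists_semiconj_iterateAlong
  obtain ⟨φ, hφ⟩ := exists_homeomorph_naturalExtension (continuous_oneSidedShiftMap A)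
    (continuous_oneSidedShiftMap B) h hc hc' hp hq
  let ιA := twoSidedShiftHomeoNaturalExtension A
  let ιB := twoSidedShiftHomeoNaturalExtension B
  have hιA := semiconj_twoSidedShiftHomeoNaturalExtension A
  have hιB := (semiconj_twoSidedShiftHomeoNaturalExtension B).inverse_left
    ιB.left_inv ιB.right_inv
  exact ⟨(ιA.trans φ).trans ιB.symm, (hιA.trans hφ).trans hιB⟩

end MarkovShifts

noncomputable section Functoriality

universe u

variable {𝒜 ℬ 𝒞 : Type u} [CStarAlgebra 𝒜] [CStarAlgebra ℬ] [CStarAlgebra 𝒞]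
  {α : 𝒜 ≃⋆ₐ[ℂ] 𝒜} {β : ℬ ≃⋆ₐ[ℂ] ℬ} {γ : 𝒞 ≃⋆ₐ[ℂ] 𝒞}

/-- The pullback of a covariant representation along an equivariant homomorphism. -/
def CovariantRep.comap (θ : 𝒜 →⋆ₐ[ℂ] ℬ) (hθ : Function.Semiconj θ α β) (ρ : CovariantRep β) :
    CovariantRep α where
  H := ρ.H
  π := ρ.π.comp θ
  U := ρ.U
  covariant a := by rw [StarAlgHom.comp_apply, ρ.covariant, ← hθ, StarAlgHom.comp_apply]

/-- Reindexing of families of operators along the pullback of covariant representations. -/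
def CovariantFamily.reindex (θ : 𝒜 →⋆ₐ[ℂ] ℬ) (hθ : Function.Semiconj θ α β) :
    CovariantFamily α →⋆ₐ[ℂ] CovariantFamily β where
  toFun f := ⟨fun ρ => f (ρ.comap θ hθ), memℓp_infty ⟨‖f‖, by
    rintro _ ⟨ρ, rfl⟩
    exact lp.norm_apply_le_norm ENNReal.top_ne_zero f (ρ.comap θ hθ)⟩⟩
  map_one' := rfl
  map_mul' _ _ := rfl
  map_zero' := rfl
  map_add' _ _ := rfl
  commutes' _ := rfl
  map_star' _ := rfl

theorem CovariantFamily.continuous_reindex (θ : 𝒜 →⋆ₐ[ℂ] ℬ) (hθ : Function.Semiconj θ α β) :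
    Continuous (reindex θ hθ) :=
  AddMonoidHomClass.continuous_of_bound _ 1 fun f => by
    simpa only [one_mul] using NonUnitalStarAlgHom.norm_apply_le (reindex θ hθ) f

theorem CovariantFamily.reindex_reindex (ψ : ℬ →⋆ₐ[ℂ] 𝒞) (hψ : Function.Semiconj ψ β γ)
    (θ : 𝒜 →⋆ₐ[ℂ] ℬ) (hθ : Function.Semiconj θ α β) (f : CovariantFamily α) :
    reindex ψ hψ (reindex θ hθ f) = reindex (ψ.comp θ) (hθ.trans hψ) f :=
  rfl

theorem CovariantFamily.reindex_eq_self {η : 𝒜 →⋆ₐ[ℂ] 𝒜} (hη : Function.Semiconj η α α)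
    (h : η = .id ℂ 𝒜) (f : CovariantFamily α) : reindex η hη f = f := by
  subst h
  rfl

theorem universalRep_mem_crossedProductSubalgebra (α : 𝒜 ≃⋆ₐ[ℂ] 𝒜) (a : 𝒜) :
    universalRep α a ∈ crossedProductSubalgebra α :=
  StarSubalgebra.le_topologicalClosure _ (StarAlgebra.subset_adjoin ℂ _ (.inl ⟨a, rfl⟩))

theorem universalUnitary_mem_crossedProductSubalgebra (α : 𝒜 ≃⋆ₐ[ℂ] 𝒜) :
    universalUnitary α ∈ crossedProductSubalgebra α :=
  StarSubalgebra.le_topologicalClosure _ (StarAlgebra.subset_adjoin ℂ _ (.inr rfl))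

theorem crossedProductSubalgebra_le_comap_reindex (θ : 𝒜 →⋆ₐ[ℂ] ℬ)
    (hθ : Function.Semiconj θ α β) :
    crossedProductSubalgebra α ≤
      (crossedProductSubalgebra β).comap (CovariantFamily.reindex θ hθ) := by
  refine StarSubalgebra.topologicalClosure_minimal (StarAlgebra.adjoin_le ?_) ?_
  · rintro _ (⟨a, rfl⟩ | rfl)
    · exact universalRep_mem_crossedProductSubalgebra β (θ a)
    · exact universalUnitary_mem_crossedProductSubalgebra β
  · exact (StarSubalgebra.isClosed_topologicalClosure _).preimage
      (CovariantFamily.continuous_reindex θ hθ)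

namespace CrossedProduct

/-- The homomorphism of crossed products induced by an equivariant homomorphism. -/
def map (θ : 𝒜 →⋆ₐ[ℂ] ℬ) (hθ : Function.Semiconj θ α β) :
    CrossedProduct α →⋆ₐ[ℂ] CrossedProduct β where
  toFun f := ⟨CovariantFamily.reindex θ hθ f.1,
    crossedProductSubalgebra_le_comap_reindex θ hθ f.2⟩
  map_one' := rfl
  map_mul' _ _ := rfl
  map_zero' := rfl
  map_add' _ _ := rfl
  commutes' _ := rfl
  map_star' _ := rfl

theorem map_map_of_comp_eq_id {ψ : ℬ →⋆ₐ[ℂ] 𝒜} (hψ : Function.Semiconj ψ β α)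
    {θ : 𝒜 →⋆ₐ[ℂ] ℬ} (hθ : Function.Semiconj θ α β) (h : ψ.comp θ = .id ℂ 𝒜)
    (f : CrossedProduct α) : map ψ hψ (map θ hθ f) = f :=
  Subtype.ext <| (CovariantFamily.reindex_reindex ψ hψ θ hθ f.1).trans
    (CovariantFamily.reindex_eq_self _ h f.1)

/-- The isomorphism of crossed products induced by an equivariant isomorphism. -/
def congr (θ : 𝒜 ≃⋆ₐ[ℂ] ℬ) (hθ : Function.Semiconj θ α β) :
    CrossedProduct α ≃⋆ₐ[ℂ] CrossedProduct β :=
  have hθ' : Function.Semiconj θ.symm β α := hθ.inverse_left θ.left_inv θ.right_inv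
  .ofStarAlgHom (map (θ : 𝒜 →⋆ₐ[ℂ] ℬ) hθ) (map (θ.symm : ℬ →⋆ₐ[ℂ] 𝒜) hθ')
    (StarAlgHom.ext <| map_map_of_comp_eq_id hθ' hθ (StarAlgHom.ext θ.symm_apply_apply))
    (StarAlgHom.ext <| map_map_of_comp_eq_id hθ hθ' (StarAlgHom.ext θ.apply_symm_apply))

/-- The isomorphism of the crossed products of conjugate homeomorphisms. -/
def congrOfSemiconj {X Y : Type u} [TopologicalSpace X] [CompactSpace X] [TopologicalSpace Y]
    [CompactSpace Y] {S : X ≃ₜ X} {T : Y ≃ₜ Y} (φ : X ≃ₜ Y) (hφ : Function.Semiconj φ S T) :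
    CrossedProduct (S.symm.compStarAlgEquiv' ℂ ℂ) ≃⋆ₐ[ℂ]
      CrossedProduct (T.symm.compStarAlgEquiv' ℂ ℂ) :=
  congr (φ.symm.compStarAlgEquiv' ℂ ℂ) fun f => by
    ext y
    have hinv : Function.Semiconj φ.symm T.symm S.symm :=
      (hφ.inverse_left φ.left_inv φ.right_inv).inverses_right T.right_inv S.left_inv
    exact congrArg f (hinv y).symm

end CrossedProduct

end Functoriality

theorem corollary5_general {N M : ℕ} {A : Matrix (Fin N) (Fin N) ℤ}
    {B : Matrix (Fin M) (Fin M) ℤ} (hAB : StronglyContinuousOrbitEquivalent A B) :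
    Nonempty (CrossedProduct (twoSidedShiftAut A) ≃⋆ₐ[ℂ] CrossedProduct (twoSidedShiftAut B)) := by
  obtain ⟨φ, hφ⟩ := hAB.exists_conjugacy
  exact ⟨CrossedProduct.congrOfSemiconj φ hφ⟩

theorem corollary5 {N M : ℕ} (hN : 1 < N) (hM : 1 < M)
    (A : Matrix (Fin N) (Fin N) ℤ) (B : Matrix (Fin M) (Fin M) ℤ)
    (hA01 : ∀ i j, A i j = 0 ∨ A i j = 1) (hB01 : ∀ i j, B i j = 0 ∨ B i j = 1)
    (hA : A.IsIrreducible) (hB : B.IsIrreducible)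
    (hAI : ConditionI A) (hBI : ConditionI B)
    (hAB : StronglyContinuousOrbitEquivalent A B) :
    Nonempty (CrossedProduct (twoSidedShiftAut A) ≃⋆ₐ[ℂ] CrossedProduct (twoSidedShiftAut B)) :=
  corollary5_general hAB
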